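/- Fix a language $L$ consisting of finitary operation symbols only (possibly infinitely many); algebras are nonempty $L$-structures. A *quasi-identity* is a sentence $$q=(\forall \bar x)\,[\varphi(\bar x)\to\psi(\bar x)],$$ where $\varphi$ is a finite (possibly empty) conjunction of equations and $\psi$ is an equation. A *quasivariety* is the class of all algebras satisfying some set of quasi-identities. Let $\mathcal Q$ be a quasivariety. Let $\mathbf F$ and $\mathbf F(k)$ be the free algebras for $\mathcal Q$ over the sets of variables $\{v_0,v_1,\dots\}$ and $\{v_0,\dots,v_{k-1}\}$ respectively, that is, the algebras of terms over these variables modulo the congruence that identifies two terms iff they determine the same term operation on every algebra from $\mathcal Q$. ($\mathbf F(0)$ exists only if $L$ has a constant symbol.) * A congruence $\alpha$ of an algebra $\mathbf A$ is a *$\mathcal Q$-congruence* if $\mathbf A/\alpha\in\mathcal Q$; for $H\subseteq A^2$, $\theta_{\mathcal Q}(H)$ is the least $\mathcal Q$-congruence of $\mathbf A$ containing $H$. An algebra is *$\mathcal Q$-finitely presented* if it is isomorphic to $\mathbf F(k)/\theta_{\mathcal Q}(H)$ for some natural number $k$ such that $\mathbf F(k)$ exists and some finite set $H\subseteq F(k)^2$.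 * A *unifier* for an algebra $\mathbf P$ is a homomorphism $\mathbf P\to\mathbf F$; $\mathbf P$ is *unifiable* if it has a unifier. * A quasi-identity $q=(\forall\bar x)[\varphi(\bar x)\to\psi(\bar x)]$ is *$\mathcal Q$-active* if $q$ is true in $\mathbf F$ and $q^*=(\forall\bar x)\,[\neg\varphi(\bar x)]$ is not true in $\mathbf F$. The quasivariety $\mathcal Q$ is *almost structurally complete* (ASC) if every $\mathcal Q$-active quasi-identity is true in all algebras from $\mathcal Q$. * $\mathsf{SP}(\mathbf F)$ is the class of all algebras isomorphic to a subalgebra of a direct power $\mathbf F^I$ of $\mathbf F$, for some set $I$. Then $\mathcal Q$ is ASC if and only if every unifiable $\mathcal Q$-finitely presented algebra belongs to $\mathsf{SP}(\mathbf F)$. Moreover, a unifiable $\mathcal Q$-finitely presented algebra $\mathbf P$ belongs to $\mathsf{SP}(\mathbf F)$ if and only if for all $a\ne b$ in $P$ there is a unifier $h\colon\mathbf P\to\mathbf F$ with $h(a)\neq h(b)$. -/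

import Mathlib

open FirstOrder

universe u v w

namespace QuasivarietyASC

open FirstOrder.Language

/-! Algebras are structures of a language `L` without relation symbols.  The signature may be
infinite, with operation symbols of every finite arity.  As usual in universal algebra, members of
a quasivariety are nonempty. -/

section Algebras

variable {L : FirstOrder.Language.{u, v}}

/-- The direct product of a family of structures, with coordinatewise operations. -/
instance piStructure {I : Type*} (B : I → Type*) [∀ i, L.Structure (B i)] :
    L.Structure (∀ i, B i) where
  funMap f x := fun i => Structure.funMap f fun j => x j i
  RelMap r x := ∀ i, Structure.RelMap r fun j => x j i

/-- The algebra of terms over a set `X` of variables. -/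
instance termStructure [L.IsAlgebraic] (X : Type*) : L.Structure (L.Term X) where
  funMap f x := Term.func f x
  RelMap r _ := isEmptyElim r

end Algebras

/-- A quasi-identity `∀ x₀ … x_{k-1}, [s₁ = t₁ ∧ … ∧ sₙ = tₙ → s = t]` (with `n = 0` allowed); an
equation is represented by the pair of its two sides. -/
structure QuasiIdentity (L : FirstOrder.Language.{u, v}) where
  /-- the number of variables -/
  k : ℕ
  /-- the conjuncts of the premise -/
  premise : List (L.Term (Fin k) × L.Term (Fin k))
  /-- the conclusion -/
  conclusion : L.Term (Fin k) × L.Term (Fin k)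

namespace QuasiIdentity

variable {L : FirstOrder.Language.{u, v}} (q : QuasiIdentity L)

/-- The premise of `q` holds in `A` at the tuple `x`. -/
def PremiseAt (A : Type w) [L.Structure A] (x : Fin q.k → A) : Prop :=
  ∀ e ∈ q.premise, e.1.realize x = e.2.realize x

/-- The conclusion of `q` holds in `A` at the tuple `x`. -/
def ConclusionAt (A : Type w) [L.Structure A] (x : Fin q.k → A) : Prop :=
  q.conclusion.1.realize x = q.conclusion.2.realize x

/-- The quasi-identity `q` is true in `A`. -/
def HoldsIn (A : Type w) [L.Structure A] : Prop :=
  ∀ x : Fin q.k → A, q.PremiseAt A x → q.ConclusionAt A x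

/-- The sentence `q* = ∀ x̄, ¬ φ(x̄)` is true in `A`, where `φ` is the premise of `q`. -/
def StarHoldsIn (A : Type w) [L.Structure A] : Prop :=
  ∀ x : Fin q.k → A, ¬ q.PremiseAt A x

end QuasiIdentity

/-- A class of algebras in the language `L`. -/
abbrev AlgebraClass (L : FirstOrder.Language.{u, v}) : Type (max (u + 1) v) :=
  ∀ (A : Type u) [L.Structure A], Prop

/-- `A ∈ SP(B)`: `A` is isomorphic to a subalgebra of a direct power of `B`. -/
def InSP (L : FirstOrder.Language.{u, v}) (B : Type u) [L.Structure B] (A : Type u) [L.Structure A] : Prop :=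
  ∃ (I : Type u) (S : L.Substructure (I → B)), Nonempty (A ≃[L] S)

section Notions

variable {L : FirstOrder.Language.{u, v}} (Q : AlgebraClass L)

/-- A quasivariety is the class of all (nonempty) algebras satisfying some set of
quasi-identities. -/
def IsQuasivariety : Prop :=
  ∃ S : Set (QuasiIdentity L), ∀ (A : Type u) [L.Structure A],
    Q A ↔ Nonempty A ∧ ∀ q ∈ S, q.HoldsIn A

/-- A congruence of an algebra: an equivalence relation compatible with all basic operations. -/
structure Congruence (L : FirstOrder.Language.{u, v}) (A : Type u) [L.Structure A] extends Setoid A where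
  /-- compatibility with the basic operations -/
  compat : ∀ {n : ℕ} (f : L.Functions n) (x y : Fin n → A), (∀ i, r (x i) (y i)) →
    r (Structure.funMap f x) (Structure.funMap f y)

variable [L.IsAlgebraic]

namespace Congruence

variable {A : Type u} [instA : L.Structure A] (c : Congruence L A)

/-- The quotient algebra `A / c` (carrier). -/
def Quot : Type u := Quotient c.toSetoid

/-- The quotient map `A → A / c`. -/
def proj (a : A) : c.Quot := Quotient.mk c.toSetoid a

instance prestructure : L.Prestructure c.toSetoid where
  toStructure := instA
  fun_equiv := fun x y h => c.compat _ x y h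
  rel_equiv := fun {_} {r} _ _ _ => isEmptyElim r

/-- The operations of the quotient algebra `A / c`. -/
instance quotStructure : L.Structure c.Quot :=
  inferInstanceAs (L.Structure (Quotient c.toSetoid))

end Congruence

/-- `c` is a `Q`-congruence: the quotient algebra by `c` belongs to `Q`. -/
def IsQCongruence {A : Type u} [L.Structure A] (c : Congruence L A) : Prop := Q c.Quot

/-- `θ_Q(H)`, the least `Q`-congruence containing `H`, as the intersection of all `Q`-congruences
containing `H` (see `theta_isQCongruence`). -/
def theta {A : Type u} [L.Structure A] (H : Set (A × A)) : Congruence L A where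
  r a b := ∀ c : Congruence L A, IsQCongruence Q c → (∀ p ∈ H, c.r p.1 p.2) → c.r a b
  iseqv :=
    { refl := fun a c _ _ => c.iseqv.refl a
      symm := fun h c hc hH => c.iseqv.symm (h c hc hH)
      trans := fun h h' c hc hH => c.iseqv.trans (h c hc hH) (h' c hc hH) }
  compat f x y h c hc hH := c.compat f x y fun i => h i c hc hH

/-- The congruence on the algebra of terms over `X` that identifies two terms iff they determine
the same term operation on every algebra from `Q`. -/
def identityCongruence (X : Type) : Congruence L (L.Term X) where
  r s t := ∀ (A : Type u) [L.Structure A], Q A → ∀ x : X → A, s.realize x = t.realize x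
  iseqv :=
    { refl := fun _ _ _ _ _ => rfl
      symm := fun h A _ hA x => (h A hA x).symm
      trans := fun h h' A _ hA x => (h A hA x).trans (h' A hA x) }
  compat f s t h A _ hA x := by
    change (Term.func f s).realize x = (Term.func f t).realize x
    simp only [Term.realize]
    congr 1
    funext i
    exact h i A hA x

/-- The free algebra for `Q` over the set `X` of variables: the quotient of the algebra of terms by
the identities of `Q`. -/
abbrev FreeAlgebra (X : Type) : Type u := (identityCongruence Q X).Quot

/-- The free algebra `𝐅` for `Q` over a countably infinite set of variables. -/
abbrev FreeOmega : Type u := FreeAlgebra Q ℕ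

/-- `P` is `Q`-finitely presented: it is isomorphic to `𝐅(k) / θ_Q(H)` for some `k` for which the
free algebra `𝐅(k)` of rank `k` exists (that is, is nonempty: `k > 0` or there is a constant) and
some finite set `H`. -/
def IsFinitelyPresented (P : Type u) [L.Structure P] : Prop :=
  ∃ k : ℕ, Nonempty (FreeAlgebra Q (Fin k)) ∧
    ∃ H : Set (FreeAlgebra Q (Fin k) × FreeAlgebra Q (Fin k)), H.Finite ∧
      Nonempty (P ≃[L] (theta Q H).Quot)

/-- `P` is unifiable in `Q`: there is a unifier for `P`, i.e. a homomorphism `P → 𝐅`. -/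
def IsUnifiable (P : Type u) [L.Structure P] : Prop := Nonempty (P →[L] FreeOmega Q)

/-- `q` is `Q`-active: `q` is true in `𝐅` and `q*` is not true in `𝐅`. -/
def IsActive (q : QuasiIdentity L) : Prop :=
  q.HoldsIn (FreeOmega Q) ∧ ¬ q.StarHoldsIn (FreeOmega Q)

/-- `Q` is almost structurally complete: every `Q`-active quasi-identity holds in `Q`. -/
def IsASC : Prop :=
  ∀ q : QuasiIdentity L, IsActive Q q → ∀ (A : Type u) [L.Structure A], Q A → q.HoldsIn A

end Notions

section Facts

variable {L : FirstOrder.Language.{u, v}} [L.IsAlgebraic] {Q : AlgebraClass L}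

theorem Congruence.realize_proj {A : Type u} [L.Structure A] (c : Congruence L A) {X : Type*}
    (t : L.Term X) (x : X → A) : t.realize (fun i => c.proj (x i)) = c.proj (t.realize x) :=
  @Term.realize_quotient_mk' L A c.toSetoid _ X t x

theorem Congruence.proj_eq {A : Type u} [L.Structure A] (c : Congruence L A) {a b : A} :
    c.proj a = c.proj b ↔ c.r a b :=
  ⟨fun h => Quotient.exact h, fun h => Quotient.sound h⟩

/-- If the algebra is nonempty, then `θ_Q(H)` is itself a `Q`-congruence; by its definition it
contains `H` and is contained in every `Q`-congruence containing `H`. -/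
theorem theta_isQCongruence (hQ : IsQuasivariety Q) {A : Type u} [L.Structure A] [Nonempty A]
    (H : Set (A × A)) : IsQCongruence Q (theta Q H) := by
  obtain ⟨S, hS⟩ := hQ
  refine (hS _).2 ⟨⟨(theta Q H).proj (Classical.arbitrary A)⟩, fun q hq x hx => ?_⟩
  have hsurj : ∀ i, ∃ a, (theta Q H).proj a = x i := fun i => Quotient.exists_rep (x i)
  choose a ha using hsurj
  obtain rfl : (fun i => (theta Q H).proj (a i)) = x := funext ha
  simp only [QuasiIdentity.ConclusionAt, QuasiIdentity.PremiseAt, Congruence.realize_proj,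
    Congruence.proj_eq] at hx ⊢
  intro c hc hH
  have := ((hS _).1 hc).2 q hq (fun i => c.proj (a i))
  simp only [QuasiIdentity.ConclusionAt, QuasiIdentity.PremiseAt, Congruence.realize_proj,
    Congruence.proj_eq] at this
  exact this fun e he => hx e he c hc hH

end Facts

end QuasivarietyASC

namespace QuasivarietyASC

open FirstOrder.Language

/-! ### Separation of points by homomorphisms -/

section

variable {L : FirstOrder.Language.{u, v}} {Q : AlgebraClass L}

/-! A quasi-identity `q` with premise `φ` corresponds to the finitely presented algebra `P =
F(k)/θ_Q(φ)`: tuples satisfying `φ` in a member `A` of `Q` are homomorphisms `P → A`. With `A = F`,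
failure of `q*` in `F` means that `P` is unifiable, and truth of `q` in `F` means that no unifier
separates the two sides of the conclusion. So ASC says that unifiers separate the points of `P`
(`IsASC.separates`, `isASC_of_separates`). Separation is membership in `SP(F)`, by evaluation at all
homomorphisms (`inSP_iff_separates`). -/

theorem realize_hom {A B X : Type*} [L.Structure A] [L.Structure B] (f : A →[L] B) (t : L.Term X)
    (x : X → A) : t.realize (fun i => f (x i)) = f (t.realize x) :=
  HomClass.realize_term f

theorem Congruence.proj_surjective {A : Type u} [L.Structure A] (c : Congruence L A) :
    Function.Surjective c.proj := fun x => Quotient.exists_rep x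

/-- A quasi-identity holds in an algebra whose points are separated by homomorphisms into algebras
that satisfy it. -/
theorem QuasiIdentity.holdsIn_of_separates (q : QuasiIdentity L) {A : Type u} [L.Structure A]
    (h : ∀ a b : A, a ≠ b → ∃ (B : Type u) (_ : L.Structure B) (_ : q.HoldsIn B) (f : A →[L] B),
      f a ≠ f b) : q.HoldsIn A := by
  intro x hx
  by_contra hne
  obtain ⟨B, _, hB, f, hf⟩ := h _ _ hne
  have := hB (fun i => f (x i)) fun e he => by
    rw [realize_hom, realize_hom, hx e he]
  rw [QuasiIdentity.ConclusionAt, realize_hom, realize_hom] at this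
  exact hf this

/-- A nonempty algebra whose points are separated by homomorphisms into members of a quasivariety
belongs to the quasivariety. -/
theorem IsQuasivariety.mem_of_separates (hQ : IsQuasivariety Q) {A : Type u} [L.Structure A]
    [Nonempty A] (h : ∀ a b : A, a ≠ b → ∃ (B : Type u) (_ : L.Structure B) (_ : Q B) (f : A →[L] B),
      f a ≠ f b) : Q A := by
  obtain ⟨S, hS⟩ := hQ
  refine (hS A).2 ⟨‹_›, fun q hq => q.holdsIn_of_separates fun a b hab => ?_⟩
  obtain ⟨B, i, hB, f, hf⟩ := h a b hab
  exact ⟨B, i, ((hS B).1 hB).2 q hq, f, hf⟩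

theorem IsQuasivariety.nonempty (hQ : IsQuasivariety Q) {A : Type u} [L.Structure A] (hA : Q A) :
    Nonempty A := by
  obtain ⟨S, hS⟩ := hQ
  exact ((hS A).1 hA).1

variable [L.IsAlgebraic]

/-! ### Homomorphisms, quotients and kernels -/

/-- A map that preserves the operations of an algebraic language is a homomorphism. -/
def homOfMapFun {A B : Type*} [L.Structure A] [L.Structure B] (f : A → B)
    (hf : ∀ {n : ℕ} (g : L.Functions n) (x : Fin n → A),
      f (Structure.funMap g x) = Structure.funMap g (f ∘ x)) : A →[L] B where
  toFun := f
  map_fun' := hf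
  map_rel' r _ := isEmptyElim r

/-- Evaluation of terms at a tuple, as a homomorphism on the algebra of terms. -/
def evalHom {X A : Type*} [L.Structure A] (x : X → A) : L.Term X →[L] A :=
  homOfMapFun (fun t => t.realize x) fun _ _ => rfl

theorem realize_var_eq_self {X : Type*} (t : L.Term X) : t.realize Term.var = t := by
  induction t with
  | var _ => rfl
  | func f ts ih =>
    change Term.func f (fun i => (ts i).realize Term.var) = _
    simp only [ih]

namespace Congruence

variable {A : Type u} [L.Structure A] (c : Congruence L A)

theorem funMap_proj {n : ℕ} (g : L.Functions n) (x : Fin n → A) :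
    Structure.funMap g (fun i => c.proj (x i)) = c.proj (Structure.funMap g x) :=
  funMap_quotient_mk' (s := c.toSetoid) g x

/-- The quotient map as a homomorphism. -/
def projHom : A →[L] c.Quot := homOfMapFun c.proj fun g x => (c.funMap_proj g x).symm

/-- A homomorphism whose kernel contains `c` factors through `A / c`. -/
def lift {B : Type*} [L.Structure B] (f : A →[L] B) (h : ∀ a b, c.r a b → f a = f b) :
    c.Quot →[L] B :=
  homOfMapFun (Quotient.lift f h) fun {n} g x => by
    choose a ha using fun i => c.proj_surjective (x i)
    obtain rfl : (fun i => c.proj (a i)) = x := funext ha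
    rw [funMap_proj]
    exact f.map_fun g a

/-- The kernel of a homomorphism. -/
def ker {B : Type*} [L.Structure B] (f : A →[L] B) : Congruence L A where
  toSetoid := Setoid.ker f
  compat g x y h := by
    change f _ = f _
    rw [f.map_fun, f.map_fun]
    exact congrArg _ (funext h)

end Congruence

/-- The quotient by the kernel embeds in `B`, so its points are separated by a single homomorphism.
Nonemptiness is needed because members of `Q` are nonempty. -/
theorem IsQuasivariety.isQCongruence_ker (hQ : IsQuasivariety Q) {A B : Type u} [L.Structure A]
    [L.Structure B] [Nonempty A] (hB : Q B) (f : A →[L] B) :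
    IsQCongruence Q (Congruence.ker f) := by
  have : Nonempty (Congruence.ker f).Quot := Nonempty.map (Congruence.ker f).proj ‹_›
  refine hQ.mem_of_separates fun a b hab => ⟨B, inferInstance, hB,
    (Congruence.ker f).lift f fun _ _ h => h, ?_⟩
  obtain ⟨a, rfl⟩ := Congruence.proj_surjective _ a
  obtain ⟨b, rfl⟩ := Congruence.proj_surjective _ b
  exact fun h => hab ((Congruence.proj_eq _).2 h)

theorem rel_of_mem_theta {A : Type u} [L.Structure A] {H : Set (A × A)} {p : A × A} (hp : p ∈ H) :
    (theta Q H).r p.1 p.2 := fun _ _ hH => hH p hp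

/-- A homomorphism into a member of `Q` that identifies the pairs in `H` factors through the
quotient by `θ_Q(H)`. -/
def thetaLift (hQ : IsQuasivariety Q) {A B : Type u} [L.Structure A] [L.Structure B] (hB : Q B)
    {H : Set (A × A)} (f : A →[L] B) (hf : ∀ p ∈ H, f p.1 = f p.2) : (theta Q H).Quot →[L] B :=
  (theta Q H).lift f fun a _ h =>
    have : Nonempty A := ⟨a⟩
    h (Congruence.ker f) (hQ.isQCongruence_ker hB f) hf

/-! ### Free algebras and membership in `Q` and `SP(F)` -/

/-- The homomorphism from a free algebra to a member of `Q` that extends an assignment of the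
variables. -/
def freeLift {X : Type} {A : Type u} [L.Structure A] (hA : Q A) (x : X → A) :
    FreeAlgebra Q X →[L] A :=
  (identityCongruence Q X).lift (evalHom x) fun _ _ h => h A hA x

theorem freeLift_proj {X : Type} {A : Type u} [L.Structure A] (hA : Q A) (x : X → A)
    (t : L.Term X) : freeLift hA x ((identityCongruence Q X).proj t) = t.realize x := rfl

/-- The generator of the free algebra that corresponds to a variable. -/
def freeGen (Q : AlgebraClass L) {X : Type} (i : X) : FreeAlgebra Q X :=
  (identityCongruence Q X).proj (Term.var i)

theorem realize_freeGen {X : Type} (t : L.Term X) :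
    t.realize (freeGen Q) = (identityCongruence Q X).proj t := by
  conv_rhs => rw [← realize_var_eq_self t]
  exact Congruence.realize_proj _ t _

/-- Free algebras of a quasivariety belong to it. -/
theorem IsQuasivariety.mem_freeAlgebra (hQ : IsQuasivariety Q) (X : Type)
    [Nonempty (FreeAlgebra Q X)] : Q (FreeAlgebra Q X) := by
  refine hQ.mem_of_separates fun a b hab => ?_
  obtain ⟨s, rfl⟩ := Congruence.proj_surjective _ a
  obtain ⟨t, rfl⟩ := Congruence.proj_surjective _ b
  by_contra! hcon
  -- If no homomorphism into `Q` separates the classes of `s` and `t`, then every assignment in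
  -- every member of `Q` gives them equal values, so the classes coincide.
  exact hab ((Congruence.proj_eq _).2 fun A _ hA x => hcon A _ hA (freeLift hA x))

theorem IsQuasivariety.mem_freeOmega (hQ : IsQuasivariety Q) : Q (FreeOmega Q) :=
  have : Nonempty (FreeAlgebra Q ℕ) := ⟨freeGen Q 0⟩
  hQ.mem_freeAlgebra ℕ

theorem IsQuasivariety.mem_of_isFinitelyPresented (hQ : IsQuasivariety Q) {P : Type u}
    [L.Structure P] (hP : IsFinitelyPresented Q P) : Q P := by
  obtain ⟨k, hk, H, -, ⟨e⟩⟩ := hP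
  have hT : Q (theta Q H).Quot := theta_isQCongruence hQ H
  have : Nonempty P := Nonempty.map e.symm (hQ.nonempty hT)
  exact hQ.mem_of_separates fun a b hab => ⟨_, inferInstance, hT, e.toHom, e.injective.ne hab⟩

/-- Membership in `SP(B)` means that homomorphisms into `B` separate points. -/
theorem inSP_iff_separates {A B : Type u} [L.Structure A] [L.Structure B] :
    InSP L B A ↔ ∀ a b : A, a ≠ b → ∃ h : A →[L] B, h a ≠ h b := by
  constructor
  · rintro ⟨I, S, ⟨e⟩⟩ a b hab
    have hne : ((e a : I → B)) ≠ (e b : I → B) := fun h => hab (e.injective (Subtype.ext h))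
    obtain ⟨i, hi⟩ := Function.ne_iff.1 hne
    refine ⟨homOfMapFun (fun a => (e a : I → B) i) fun g x => ?_, hi⟩
    rw [e.map_fun]
    rfl
  · intro h
    -- The index set of the power is the set of all homomorphisms; it lies in the universe required
    -- by `InSP`.
    let f : A →[L] ((A →[L] B) → B) :=
      homOfMapFun (fun a φ => φ a) fun g x => funext fun φ => φ.map_fun g x
    have hf : Function.Injective f := fun a b hab => by
      by_contra hne
      obtain ⟨φ, hφ⟩ := h a b hne
      exact hφ (congrFun hab φ)
    let f' : A ↪[L] ((A →[L] B) → B) :=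
      { toFun := f
        inj' := hf
        map_fun' := f.map_fun'
        map_rel' := fun r _ => isEmptyElim r }
    exact ⟨A →[L] B, f'.toHom.range, ⟨f'.equivRange⟩⟩

/-! ### The two implications -/

/-- In an almost structurally complete quasivariety, the unifiers of a unifiable finitely presented
algebra separate its points. -/
theorem IsASC.separates (hQ : IsQuasivariety Q) (hA : IsASC Q) {P : Type u} [L.Structure P]
    (hP : IsFinitelyPresented Q P) (hu : IsUnifiable Q P) (a b : P) (hab : a ≠ b) :
    ∃ h : P →[L] FreeOmega Q, h a ≠ h b := by
  have hPQ := hQ.mem_of_isFinitelyPresented hP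
  obtain ⟨k, hk, H, hH, ⟨e⟩⟩ := hP
  obtain ⟨u⟩ := hu
  let π : FreeAlgebra Q (Fin k) →[L] P := e.symm.toHom.comp (theta Q H).projHom
  have hπ : Function.Surjective π := e.symm.surjective.comp (theta Q H).proj_surjective
  have hπH : ∀ p ∈ H, π p.1 = π p.2 := fun p hp =>
    congrArg e.symm ((Congruence.proj_eq _).2 (rel_of_mem_theta hp))
  let gen : Fin k → P := fun i => π (freeGen Q i)
  have hgen : ∀ t : L.Term (Fin k), t.realize gen = π ((identityCongruence Q _).proj t) := by
    intro t
    rw [← realize_freeGen]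
    exact realize_hom π t _
  obtain ⟨a, rfl⟩ := hπ a
  obtain ⟨b, rfl⟩ := hπ b
  obtain ⟨s, rfl⟩ := Congruence.proj_surjective _ a
  obtain ⟨t, rfl⟩ := Congruence.proj_surjective _ b
  choose rep hrep using (identityCongruence Q (Fin k)).proj_surjective
  -- The premise presents `P` by term representatives of the pairs in `H`, which finiteness of `H`
  -- permits; the conclusion equates the two points to be separated.
  let q : QuasiIdentity L :=
    ⟨k, hH.toFinset.toList.map fun p => (rep p.1, rep p.2), (s, t)⟩
  have hprem : ∀ (A : Type u) [L.Structure A] (hA : Q A) (x : Fin k → A),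
      q.PremiseAt A x ↔ ∀ p ∈ H, freeLift hA x p.1 = freeLift hA x p.2 := by
    intro A _ hA x
    have hx : ∀ z, (rep z).realize x = freeLift hA x z := fun z => by
      conv_rhs => rw [← hrep z, freeLift_proj]
    simp only [QuasiIdentity.PremiseAt, q, List.forall_mem_map, Finset.mem_toList,
      Set.Finite.mem_toFinset]
    exact forall₂_congr fun p _ => Eq.congr (hx p.1) (hx p.2)
  have hgen' : ∀ z, freeLift hPQ gen z = π z := fun z => by
    obtain ⟨t, rfl⟩ := Congruence.proj_surjective _ z
    exact hgen t
  have hgenP : q.PremiseAt P gen := (hprem P hPQ gen).2 fun p hp => by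
    rw [hgen', hgen', hπH p hp]
  by_contra! hcon
  -- A tuple in `F` satisfying the premise induces a unifier of `P`, and by assumption this unifier
  -- identifies the two points.
  have hq : q.HoldsIn (FreeOmega Q) := by
    intro x hx
    rw [hprem _ hQ.mem_freeOmega] at hx
    have := hcon ((thetaLift hQ hQ.mem_freeOmega (freeLift hQ.mem_freeOmega x) hx).comp e.toHom)
    have key : ∀ z, ((thetaLift hQ hQ.mem_freeOmega (freeLift hQ.mem_freeOmega x) hx).comp
        e.toHom) (π z) = freeLift hQ.mem_freeOmega x z := fun z =>
      congrArg (thetaLift hQ hQ.mem_freeOmega (freeLift hQ.mem_freeOmega x) hx)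
        (e.apply_symm_apply _)
    rw [key, key] at this
    exact this
  -- The image of the generators of `P` under the given unifier satisfies the premise.
  have hstar : ¬ q.StarHoldsIn (FreeOmega Q) := fun h =>
    h (fun i => u (gen i)) fun e he => by
      rw [realize_hom u e.1 gen, realize_hom u e.2 gen, hgenP e he]
  have := hA q ⟨hq, hstar⟩ P hPQ gen hgenP
  rw [QuasiIdentity.ConclusionAt, hgen, hgen] at this
  exact hab this

/-- If unifiers separate the points of all unifiable finitely presented algebras, then the
quasivariety is almost structurally complete. -/
theorem isASC_of_separates (hQ : IsQuasivariety Q)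
    (h : ∀ (P : Type u) [L.Structure P], IsFinitelyPresented Q P → IsUnifiable Q P →
      ∀ a b : P, a ≠ b → ∃ h : P →[L] FreeOmega Q, h a ≠ h b) : IsASC Q := by
  rintro q ⟨hqF, hstar⟩ A _ hA x hx
  let π := (identityCongruence Q (Fin q.k)).proj
  -- The conclusion of `q` supplies a term, so `F(k)` exists even when `k = 0`.
  have hne : Nonempty (FreeAlgebra Q (Fin q.k)) := ⟨π q.conclusion.1⟩
  let H : Set (FreeAlgebra Q (Fin q.k) × FreeAlgebra Q (Fin q.k)) :=
    (fun e => (π e.1, π e.2)) '' {e | e ∈ q.premise}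
  have hlift : ∀ (B : Type u) [L.Structure B] (hB : Q B) (y : Fin q.k → B), q.PremiseAt B y →
      ∀ p ∈ H, freeLift hB y p.1 = freeLift hB y p.2 := by
    rintro B _ hB y hy _ ⟨e, he, rfl⟩
    exact hy e he
  have hfp : IsFinitelyPresented Q (theta Q H).Quot :=
    ⟨q.k, hne, H, (List.finite_toSet q.premise).image _, ⟨FirstOrder.Language.Equiv.refl L _⟩⟩
  have hun : IsUnifiable Q (theta Q H).Quot := by
    simp only [QuasiIdentity.StarHoldsIn, not_forall, not_not] at hstar
    obtain ⟨y, hy⟩ := hstar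
    exact ⟨thetaLift hQ hQ.mem_freeOmega _ (hlift _ hQ.mem_freeOmega y hy)⟩
  have hqP : q.HoldsIn (theta Q H).Quot := q.holdsIn_of_separates fun a b hab => by
    obtain ⟨f, hf⟩ := h _ hfp hun a b hab
    exact ⟨_, inferInstance, hqF, f, hf⟩
  have hreal : ∀ t : L.Term (Fin q.k),
      t.realize (fun i => (theta Q H).proj (freeGen Q i)) = (theta Q H).proj (π t) := fun t => by
    rw [Congruence.realize_proj]
    exact congrArg _ (realize_freeGen t)
  have hcon := hqP (fun i => (theta Q H).proj (freeGen Q i)) fun e he => by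
    rw [hreal, hreal]
    exact (Congruence.proj_eq _).2 (rel_of_mem_theta (p := (π e.1, π e.2)) ⟨e, he, rfl⟩)
  rw [QuasiIdentity.ConclusionAt, hreal, hreal] at hcon
  -- The tuple `x` induces a homomorphism from the presented algebra to `A`, which carries the
  -- conclusion from the generators to `x`.
  exact congrArg (thetaLift hQ hA _ (hlift A hA x hx)) hcon

end

end QuasivarietyASC

theorem corollary3p3 {L : FirstOrder.Language.{u, v}} [L.IsAlgebraic]
    (Q : QuasivarietyASC.AlgebraClass.{u, v} L) (hQ : QuasivarietyASC.IsQuasivariety Q) :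
    (QuasivarietyASC.IsASC Q ↔
      ∀ (P : Type u) [L.Structure P], QuasivarietyASC.IsFinitelyPresented Q P →
        QuasivarietyASC.IsUnifiable Q P → QuasivarietyASC.InSP L (QuasivarietyASC.FreeOmega Q) P) ∧
    (∀ (P : Type u) [L.Structure P], QuasivarietyASC.IsFinitelyPresented Q P →
      QuasivarietyASC.IsUnifiable Q P →
      (QuasivarietyASC.InSP L (QuasivarietyASC.FreeOmega Q) P ↔
        ∀ a b : P, a ≠ b → ∃ h : P →[L] QuasivarietyASC.FreeOmega Q, h a ≠ h b)) := by
  refine ⟨⟨fun h P _ hP hu => QuasivarietyASC.inSP_iff_separates.2 (h.separates hQ hP hu),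
    fun h => QuasivarietyASC.isASC_of_separates hQ fun P _ hP hu =>
      QuasivarietyASC.inSP_iff_separates.1 (h P hP hu)⟩,
    fun P _ _ _ => QuasivarietyASC.inSP_iff_separates⟩
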